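/- **Setting.** Let $\Sigma^I$ be a finite input alphabet and $\Sigma^O\subseteq\mathbb{Q}$ an output alphabet. A deterministic quantitative automaton $\mathcal{A}$ has a set of states $Q$, an initial state $q_0$, a transition function $\delta:Q\times\Sigma^I\to Q$ and a labeling $L:Q\to\mathbb{Q}$, and a valuation of one of four forms: $\mathcal{A}(s)=\sum_{i=0}^{|s|}L(\delta(q_0,s_{:i}))$ (summation), $\sum_{i=0}^{|s|}\gamma^iL(\delta(q_0,s_{:i}))$ with $\gamma\ne0$ (discounted summation), $\prod_{i=0}^{|s|}L(\delta(q_0,s_{:i}))$ with $\Sigma^O\subseteq\mathbb{Q}_{>0}$ (product), or $L(\delta(q_0,s))$ (classification), where $s_{:i}$ is the prefix of $s$ of length $i$. The target $\mathcal{V}:(\Sigma^I)^*\to\mathbb{Q}$ is the valuation, of the given form, of some automaton with finitely many states and labels in $\Sigma^O$, with $\mathcal{V}(\varepsilon)=0$ for the two sums and $\mathcal{V}(\varepsilon)=1$ for products. A preference query on $s_1,s_2$ returns the sign of $\mathcal{V}(s_1)-\mathcal{V}(s_2)$. An equivalence query on $h$ returns "correct" if $h(s)=\mathcal{V}(s)$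 for all $s$, and otherwise some $c$ with $h(c)\neq\mathcal{V}(c)$ together with the feedback constraint $\mathbf{Val}(c)=\mathcal{V}(c)$ (strong feedback) or $\mathbf{Val}(c)\ne h(c)$ (weak feedback). **Algorithm (QUINTIC).** A table is a pair of finite sets of sequences $S,E\ni\varepsilon$, with $S$ prefix-closed and $E$ prefix- and suffix-closed; it has one variable for each sequence in $(S\cup S\cdot\Sigma^I)\cdot E$. A solution $\Lambda$ assigns letters of $\Sigma^O$ to the variables, respecting the value $0$ (sums) or $1$ (products) of the variable of $\varepsilon$ and all answers to preference queries between sequences of the table; it induces a set of equivalence classes $\mathcal{E}$ (two variables are equivalent iff they get the same value). Row $s$ of the table unified by $\mathcal{E}$ lists, over $e\in E$, the class of the variable of $s\cdot e$. The unified table is closed if every row of $S\cdot\Sigma^I$ is a row of $S$, and consistent if equal rows $s_1,s_2\in S$ have equal rows $s_1\sigma,s_2\sigma$ for all $\sigma\in\Sigma^I$. A closed and consistent table gives a hypothesis whose states are the distinct rows of $S$, with initial state row $\varepsilon$, $\delta(\mathrm{row}\,s,\sigma)=\mathrm{row}\,s\sigma$ and $L(\mathrm{row}\,s)=\Lambda(s)$.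 QUINTIC searches depth first over chains of pairs $(\mathcal{E},\text{table})$ with a bound $M$ on the number of equivalence class sets in a chain, starting with $M=1$ and $S=E=\{\varepsilon\}$. It selects an $\mathcal{E}$ induced by a solution for the current table, consistent with the preceding one in the chain, and not yet ruled out at this point of the chain. If the unified table is not closed or not consistent, it repairs one defect, by adding an $s\cdot\sigma$ with a new row to $S$, or by adding to $E$ a sequence $\sigma\cdot e$ that separates the successors of two equal rows, with all its prefixes; this extends the chain. Otherwise it asks equivalence queries for the hypotheses given by solutions inducing exactly $\mathcal{E}$ that satisfy all feedback constraints collected so far, until one is correct, which is returned, or none is left; in the latter case $\mathcal{E}$ is ruled out and the counterexamples found are added to $S$ with all their prefixes. If no $\mathcal{E}$ can be selected, it backtracks along the chain; if the chain is empty, $M$ is increased by $1$ and a shortest sequence without a variable (if there is one) is added to $S$ with all its prefixes. The order of selections and repairs and the choice of counterexamples are arbitrary. **Theorem (Minimalism).** QUINTIC results in a minimal automaton: 1. every automaton $h$ that QUINTIC can return has finitely many states and labels in $\Sigma^O$, satisfies $h(s)=\mathcal{V}(s)$ for all $s\in(\Sigma^I)^*$, and has the fewest states among all finite-state automata (with arbitrary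 rational labels and the same form of valuation) that agree with $\mathcal{V}$ on all sequences; 2. a run of QUINTIC can stop only by returning an automaton, and if $\Sigma^O$ is finite, there is no infinite run. So every run then returns a minimal automaton. -/

import Mathlib

universe u v w

namespace Quintic

/-! ### Valuation functions and deterministic quantitative automata -/

/-- The four algebraic forms of valuation function. -/
inductive ValForm where
  | sum
  | discounted (γ : ℚ)
  | product
  | classification

/-- Value of the sequence `s` when the label generated after reading a prefix `p` is `ℓ p`.
For `ℓ p = L (δ (q₀, p))` this is the value of `s` in an automaton; for `ℓ` an assignment of values
to the variables of an observation table it is the value of `s` in terms of those variables.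
It satisfies `Val (s·σ) = ℓ (s·σ) + Val s`, and similarly for the other forms. -/
def ValForm.val {α : Type u} (F : ValForm) (ℓ : List α → ℚ) (s : List α) : ℚ :=
  match F with
  | .sum => ∑ i ∈ Finset.range (s.length + 1), ℓ (s.take i)
  | .discounted γ => ∑ i ∈ Finset.range (s.length + 1), γ ^ i * ℓ (s.take i)
  | .product => ∏ i ∈ Finset.range (s.length + 1), ℓ (s.take i)
  | .classification => ℓ s

/-- The initial condition `Val ε = T ε = 0` (sums), `Val ε = T ε = 1` (products). -/
def ValForm.Init : ValForm → ℚ → Prop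
  | .sum, x => x = 0
  | .discounted _, x => x = 0
  | .product, x => x = 1
  | .classification, _ => True

/-- Discount factors are nonzero; the output alphabet for products is positive. -/
def ValForm.Admissible : ValForm → Set ℚ → Prop
  | .sum, _ => True
  | .discounted γ, _ => γ ≠ 0
  | .product, Out => ∀ x ∈ Out, 0 < x
  | .classification, _ => True

/-- A deterministic automaton over the input alphabet `α` whose states carry rational labels. -/
structure Automaton (α : Type u) where
  Q : Type v
  start : Q
  next : Q → α → Q
  label : Q → ℚ

/-- State reached from the initial state along `s`. -/
def Automaton.run {α : Type u} (A : Automaton.{u, v} α) (s : List α) : A.Q :=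
  s.foldl A.next A.start

/-- The value `A(s)` of the input sequence `s` under the valuation function `F`. -/
def Automaton.eval {α : Type u} (A : Automaton.{u, v} α) (F : ValForm) (s : List α) : ℚ :=
  F.val (fun p => A.label (A.run p)) s

/-- `A` agrees with the target valuation `V` on every input sequence. -/
def Automaton.Computes {α : Type u} (A : Automaton.{u, v} α) (F : ValForm) (V : List α → ℚ) :
    Prop :=
  ∀ s, A.eval F s = V s

/-! ### The teacher -/

/-- Strong feedback reveals the value of a counterexample; weak feedback only says that the
hypothesis has the wrong value. -/
inductive FeedbackKind where
  | strong
  | weak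

/-- A learning problem: form of the valuation, output alphabet, target valuation, and the kind of
feedback that the teacher gives. -/
structure Problem (α : Type u) where
  form : ValForm
  Out : Set ℚ
  V : List α → ℚ
  feedback : FeedbackKind

/-- Answer to a preference query when preferences follow the valuation `V`. -/
def prefQ {α : Type u} (V : List α → ℚ) (s₁ s₂ : List α) : ℤ :=
  if V s₁ > V s₂ then 1 else if V s₁ = V s₂ then 0 else -1

/-- Constraints `Val c = x` and `Val c ≠ x` obtained from equivalence queries. -/
inductive ValueConstraint (α : Type u) where
  | eq (c : List α) (x : ℚ)
  | ne (c : List α) (x : ℚ)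

def ValueConstraint.Holds {α : Type u} (f : List α → ℚ) : ValueConstraint α → Prop
  | .eq c x => f c = x
  | .ne c x => f c ≠ x

/-- The constraint learned from the counterexample `c` to a hypothesis with valuation `f`. -/
def Problem.respond {α : Type u} (P : Problem α) (f : List α → ℚ) (c : List α) :
    ValueConstraint α :=
  match P.feedback with
  | .strong => .eq c (P.V c)
  | .weak => .ne c (f c)

/-! ### Symbolic observation tables -/

/-- The prefix set `S` and suffix set `E` of a symbolic observation table. The variable `Γ[t]` of a
sequence `t` is named by `t` itself, so that the entry of row `s` and column `e` is `s ++ e`. -/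
structure Table (α : Type u) where
  S : Set (List α)
  E : Set (List α)
  finite_S : S.Finite
  finite_E : E.Finite
  nil_S : [] ∈ S
  nil_E : [] ∈ E
  prefix_S : ∀ s ∈ S, ∀ p, p <+: s → p ∈ S
  prefix_E : ∀ e ∈ E, ∀ p, p <+: e → p ∈ E
  suffix_E : ∀ e ∈ E, ∀ p, p <:+ e → p ∈ E

theorem finite_prefixes {α : Type u} (c : List α) : {p : List α | p <+: c}.Finite :=
  (List.finite_toSet c.inits).subset fun p hp => by simpa using hp

namespace Table

variable {α : Type u}

/-- The table with `S = {ε}` and `E = {ε}`. -/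
def initial : Table α where
  S := {[]}
  E := {[]}
  finite_S := Set.finite_singleton _
  finite_E := Set.finite_singleton _
  nil_S := rfl
  nil_E := rfl
  prefix_S := by rintro s rfl p hp; simpa using hp
  prefix_E := by rintro s rfl p hp; simpa using hp
  suffix_E := by rintro s rfl p hp; simpa using hp

/-- Add the given sequences and all their prefixes to `S`. -/
def addPrefixes (O : Table α) (cs : List (List α)) : Table α where
  S := O.S ∪ {p | ∃ c ∈ cs, p <+: c}
  E := O.E
  finite_S := O.finite_S.union <|
    ((List.finite_toSet cs).biUnion fun c _ => finite_prefixes c).subset fun p hp => by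
      simpa using hp
  finite_E := O.finite_E
  nil_S := Or.inl O.nil_S
  nil_E := O.nil_E
  prefix_S := by
    rintro s (hs | ⟨c, hc, hs⟩) p hp
    · exact Or.inl (O.prefix_S s hs p hp)
    · exact Or.inr ⟨c, hc, hp.trans hs⟩
  prefix_E := O.prefix_E
  suffix_E := O.suffix_E

/-- Add `σ · e` and all its prefixes to `E`, for a column `e`. -/
def addSuffix (O : Table α) (σ : α) (e : List α) (he : e ∈ O.E) : Table α where
  S := O.S
  E := O.E ∪ {p | p <+: σ :: e}
  finite_S := O.finite_S
  finite_E := O.finite_E.union (finite_prefixes _)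
  nil_S := O.nil_S
  nil_E := Or.inl O.nil_E
  prefix_S := O.prefix_S
  prefix_E := by
    rintro s (hs | hs) p hp
    · exact Or.inl (O.prefix_E s hs p hp)
    · exact Or.inr (List.IsPrefix.trans hp hs)
  suffix_E := by
    rintro s (hs | hs) p hp
    · exact Or.inl (O.suffix_E s hs p hp)
    · rcases List.prefix_cons_iff.1 (show s <+: σ :: e from hs) with rfl | ⟨t, rfl, ht⟩
      · exact Or.inl (by rw [List.suffix_nil.1 hp]; exact O.nil_E)
      · rcases List.suffix_cons_iff.1 hp with rfl | hp
        · exact Or.inr hs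
        · exact Or.inl (O.suffix_E t (O.prefix_E e he t ht) p hp)

/-- The sequences `(S ∪ S·Σᴵ)·E`, that is, the variables of the table. -/
def dom (O : Table α) : Set (List α) :=
  {t | ∃ s ∈ O.S, ∃ e ∈ O.E, t = s ++ e ∨ ∃ σ : α, t = s ++ [σ] ++ e}

end Table

/-! ### Constraints and equivalence classes of variables -/

/-- A set of equivalence classes, as the set of all pairs of equivalent variables. -/
abbrev EqClasses (α : Type u) := Set (List α × List α)

/-- The equivalence classes into which the assignment `Λ` sorts the variables in `D`: two variables
are equivalent if and only if they get the same value. -/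
def classesOf {α : Type u} (D : Set (List α)) (Λ : List α → ℚ) : EqClasses α :=
  {p | p.1 ∈ D ∧ p.2 ∈ D ∧ Λ p.1 = Λ p.2}

/-- `Λ` assigns output letters to the variables of `O` and satisfies the initial condition and the
constraints obtained from the preference queries between all sequences of the table. -/
def Problem.Solves {α : Type u} (P : Problem α) (O : Table α) (Λ : List α → ℚ) : Prop :=
  (∀ t ∈ O.dom, Λ t ∈ P.Out) ∧ P.form.Init (Λ []) ∧
    ∀ s ∈ O.dom, ∀ t ∈ O.dom, prefQ (P.form.val Λ) s t = prefQ P.V s t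

/-- `𝓔` is a set of equivalence classes satisfying the preference constraints. -/
def Problem.Feasible {α : Type u} (P : Problem α) (O : Table α) (𝓔 : EqClasses α) : Prop :=
  ∃ Λ, P.Solves O Λ ∧ classesOf O.dom Λ = 𝓔

namespace Table

variable {α : Type u}

/-- The row of `s` in the table unified by `𝓔`; the representative of a variable is its class. -/
def row (O : Table α) (𝓔 : EqClasses α) (s : List α) : O.E → Set (List α) :=
  fun e => {t | (s ++ e, t) ∈ 𝓔}

def Closed (O : Table α) (𝓔 : EqClasses α) : Prop :=
  ∀ s ∈ O.S, ∀ σ : α, ∃ s' ∈ O.S, O.row 𝓔 s' = O.row 𝓔 (s ++ [σ])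

def Consistent (O : Table α) (𝓔 : EqClasses α) : Prop :=
  ∀ s₁ ∈ O.S, ∀ s₂ ∈ O.S, O.row 𝓔 s₁ = O.row 𝓔 s₂ →
    ∀ σ : α, O.row 𝓔 (s₁ ++ [σ]) = O.row 𝓔 (s₂ ++ [σ])

/-- One expansion of a unified table that is not closed or not consistent: either a row of `S·Σᴵ`
that is not a row of `S` is moved to `S`, or a column that separates the successors of two equal
rows is added. -/
inductive Expand (O : Table α) (𝓔 : EqClasses α) : Table α → Prop
  | close (s : List α) (σ : α) (hs : s ∈ O.S)
      (hrow : ∀ s' ∈ O.S, O.row 𝓔 s' ≠ O.row 𝓔 (s ++ [σ])) :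
      Expand O 𝓔 (O.addPrefixes [s ++ [σ]])
  | separate (s₁ s₂ : List α) (σ : α) (e : List α) (h₁ : s₁ ∈ O.S) (h₂ : s₂ ∈ O.S)
      (he : e ∈ O.E) (hrow : O.row 𝓔 s₁ = O.row 𝓔 s₂)
      (hne : O.row 𝓔 (s₁ ++ [σ]) ⟨e, he⟩ ≠ O.row 𝓔 (s₂ ++ [σ]) ⟨e, he⟩) :
      Expand O 𝓔 (O.addSuffix σ e he)

/-- Forced expansion: a shortest sequence that has no variable yet is added to the table. (If there
is no such sequence, which requires an empty alphabet, nothing is added.) -/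
def ForceExpand (O O' : Table α) : Prop :=
  (∃ t, t ∉ O.dom ∧ (∀ t', t' ∉ O.dom → t.length ≤ t'.length) ∧ O' = O.addPrefixes [t]) ∨
    ((∀ t, t ∈ O.dom) ∧ O' = O)

/-- The hypothesis read off from a closed (and consistent) table unified by `𝓔`, with output values
given by `Λ`: states are the distinct rows of `S`, the initial state is the row of `ε`, the
`σ`-successor of the row of `s` is the row of `s·σ`, and its label is `Λ[T(s·ε)]`. -/
noncomputable def hypothesis (O : Table α) (𝓔 : EqClasses α) (Λ : List α → ℚ)
    (hc : O.Closed 𝓔) : Automaton.{u, u} α where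
  Q := {r : O.E → Set (List α) // ∃ s ∈ O.S, O.row 𝓔 s = r}
  start := ⟨O.row 𝓔 [], [], O.nil_S, rfl⟩
  next r σ := ⟨O.row 𝓔 (r.2.choose ++ [σ]), hc _ r.2.choose_spec.1 σ⟩
  label r := Λ r.2.choose

end Table

/-- `h` is a concrete hypothesis under the symbolic hypothesis given by `O` and `𝓔`: its output
values solve the preference constraints and sort the variables exactly into the classes `𝓔`, and it
satisfies the feedback constraints `B`. -/
def Problem.ValidHyp {α : Type u} (P : Problem α) (O : Table α) (𝓔 : EqClasses α)
    (B : List (ValueConstraint α)) (h : Automaton.{u, u} α) : Prop :=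
  ∃ (hc : O.Closed 𝓔) (Λ : List α → ℚ), P.Solves O Λ ∧ classesOf O.dom Λ = 𝓔 ∧
    h = O.hypothesis 𝓔 Λ hc ∧ ∀ b ∈ B, b.Holds (h.eval P.form)

/-! ### The algorithm -/

/-- An element `(O_k, 𝓔_{k+1})` of a conjecture–expansion chain, with the equivalence class sets
already ruled out at this point of the chain. -/
structure Node (α : Type u) where
  table : Table α
  tried : Set (EqClasses α)
  classes : EqClasses α

/-- `𝓔` is consistent with the latest equivalence class set of the chain. -/
def ExtendsChain {α : Type u} : List (Node α) → EqClasses α → Prop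
  | [], _ => True
  | n :: _, 𝓔 => ∀ s ∈ n.table.dom, ∀ t ∈ n.table.dom, (s, t) ∈ 𝓔 ↔ (s, t) ∈ n.classes

/-- Control states. `M` is the maximal length of a chain, `chain` the current chain (latest element
first), `O` the current table, `tried` the equivalence class sets ruled out at this point of the
chain, `B` the feedback constraints.
* `fill`: an equivalence class set for `O` is to be selected;
* `unified`: `𝓔` has been selected;
* `test`: the concrete hypotheses under `O` and `𝓔` are being tested, with counterexamples `cex`
  so far;
* `done`: the algorithm has returned `h`. -/
inductive State (α : Type u) where
  | fill (M : ℕ) (chain : List (Node α)) (O : Table α) (tried : Set (EqClasses α))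
      (B : List (ValueConstraint α))
  | unified (M : ℕ) (chain : List (Node α)) (O : Table α) (tried : Set (EqClasses α))
      (B : List (ValueConstraint α)) (𝓔 : EqClasses α)
  | test (M : ℕ) (chain : List (Node α)) (O : Table α) (tried : Set (EqClasses α))
      (B : List (ValueConstraint α)) (𝓔 : EqClasses α) (cex : List (List α))
  | done (h : Automaton.{u, u} α)

/-- The equivalence class sets that may be selected next. -/
def Problem.Selectable {α : Type u} (P : Problem α) (M : ℕ) (chain : List (Node α)) (O : Table α)
    (tried : Set (EqClasses α)) (𝓔 : EqClasses α) : Prop :=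
  chain.length < M ∧ P.Feasible O 𝓔 ∧ ExtendsChain chain 𝓔 ∧ 𝓔 ∉ tried

/-- One step of QUINTIC. The order in which the solver proposes equivalence class sets and concrete
hypotheses, the defect of a table that is repaired first, and the counterexamples that the teacher
gives are arbitrary. -/
inductive Step {α : Type u} (P : Problem α) : State α → State α → Prop
  /- SymbolicFill: conjecture an equivalence class set. -/
  | select {M chain O tried B 𝓔} (h : P.Selectable M chain O tried 𝓔) :
      Step P (.fill M chain O tried B) (.unified M chain O tried B 𝓔)
  /- SymbolicFill with backtracking: remove the latest element of the chain. -/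
  | backtrack {M n chain O tried B} (h : ∀ 𝓔, ¬ P.Selectable M (n :: chain) O tried 𝓔) :
      Step P (.fill M (n :: chain) O tried B)
        (.fill M chain n.table (insert n.classes n.tried) B)
  /- Iterative deepening: all chains are exhausted, so raise the budget and expand the table. -/
  | deepen {M O O' tried B} (h : ∀ 𝓔, ¬ P.Selectable M [] O tried 𝓔)
      (hO : O.ForceExpand O') :
      Step P (.fill M [] O tried B) (.fill (M + 1) [] O' ∅ B)
  /- MakeClosedAndConsistent: the table is expanded, and the chain grows. -/
  | expand {M chain O tried B 𝓔 O'} (h : O.Expand 𝓔 O') :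
      Step P (.unified M chain O tried B 𝓔) (.fill M (⟨O, tried, 𝓔⟩ :: chain) O' ∅ B)
  /- MakeSymbolicHypothesis: the constraints are unsatisfiable under the symbolic hypothesis. -/
  | unsat {M chain O tried B 𝓔} (hc : O.Closed 𝓔) (hk : O.Consistent 𝓔)
      (h : ∀ a, ¬ P.ValidHyp O 𝓔 B a) :
      Step P (.unified M chain O tried B 𝓔) (.fill M chain O (insert 𝓔 tried) B)
  /- MakeSymbolicHypothesis: the constraints are satisfiable under the symbolic hypothesis. -/
  | sat {M chain O tried B 𝓔 a} (hc : O.Closed 𝓔) (hk : O.Consistent 𝓔)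
      (h : P.ValidHyp O 𝓔 B a) :
      Step P (.unified M chain O tried B 𝓔) (.test M chain O tried B 𝓔 [])
  /- An equivalence query is answered positively, and the hypothesis is returned. -/
  | accept {M chain O tried B 𝓔 cex a} (h : P.ValidHyp O 𝓔 B a)
      (hV : a.Computes P.form P.V) :
      Step P (.test M chain O tried B 𝓔 cex) (.done a)
  /- An equivalence query is answered by a counterexample, and feedback is recorded. -/
  | refute {M chain O tried B 𝓔 cex a c} (h : P.ValidHyp O 𝓔 B a)
      (hV : a.eval P.form c ≠ P.V c) :
      Step P (.test M chain O tried B 𝓔 cex)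
        (.test M chain O tried (P.respond (a.eval P.form) c :: B) 𝓔 (c :: cex))
  /- No concrete hypothesis is left: drop `𝓔`, and expand the table with the counterexamples. -/
  | reject {M chain O tried B 𝓔 cex} (h : ∀ a, ¬ P.ValidHyp O 𝓔 B a) :
      Step P (.test M chain O tried B 𝓔 cex)
        (.fill M chain (O.addPrefixes cex) (insert 𝓔 tried) B)

/-- Start of the algorithm: `S = E = {ε}`, no constraints, budget `1`. -/
def State.initial {α : Type u} : State α := .fill 1 [] Table.initial ∅ []

/-- `σ` occurs in some run of QUINTIC. -/
def Reachable {α : Type u} (P : Problem α) (σ : State α) : Prop :=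
  Relation.ReflTransGen (Step P) State.initial σ

end Quintic

/-!
An automaton is determined by its labels, and the labels are determined by the valuation
(`ValForm.eq_of_val_eq`). A hypothesis from a closed and consistent table generates the label
`Λ t` at every variable `t` (`Table.hypothesis_output`); distinct states of it are told apart by
some column, so it is no larger than any automaton with the same valuation
(`Table.card_hypothesis_le`).

For termination, fix a target automaton `A` and consider the equivalence classes of variables under
the labels of `A`, the true classes. Each deepening adds a shortest missing sequence, so for a
large budget the prefixes `S` of every table reach all states of `A`. From then on a table unified
by the true classes is closed, every repair of an inconsistency yields a new row, of which there
are at most as many as states of `A`, and a consistent table has a hypothesis with the target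
valuation (`IsTarget.hypothesis_computes`), which satisfies all feedback. Hence the path of true
classes is never ruled out, and the budget is never raised again (`IsTarget.selectable`, `IsTarget.ne_trueClasses`).

With a bounded budget, columns have bounded length, because the root of a chain has the only column
`ε` and each element of a chain lengthens columns by at most one letter. With finitely many output
letters there are thus finitely many valuations of hypotheses. Every counterexample excludes one of
them for good, so tables are enlarged by counterexamples only finitely often. In between, the
algorithm is a depth-first search of bounded depth and finite branching. The lexicographic rank
`State.rank` combines these three facts (`IsTarget.lexLT_of_step`).
-/

namespace Quintic

/-! ### Valuations determine labels -/

/-- The values of a labeling with admissible output letters determine the labels of any labeling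
with the same values, even if the latter uses arbitrary rationals. -/
theorem ValForm.eq_of_val_eq {α : Type u} {F : ValForm} {Out : Set ℚ} (hF : F.Admissible Out)
    {ℓ ℓ' : List α → ℚ} (hℓ : ∀ s, ℓ s ∈ Out) (h : ∀ s, F.val ℓ' s = F.val ℓ s) (s : List α) :
    ℓ' s = ℓ s := by
  induction hn : s.length using Nat.strong_induction_on generalizing s with
  | _ n ih =>
    have hlt : ∀ i ∈ Finset.range s.length, ℓ' (s.take i) = ℓ (s.take i) := fun i hi =>
      ih (s.take i).length (by simp at hi ⊢; omega) _ rfl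
    have hs := h s
    cases F with
    | sum =>
      simp only [val, Finset.sum_range_succ, List.take_length] at hs
      rw [Finset.sum_congr rfl hlt] at hs
      exact add_left_cancel hs
    | discounted γ =>
      simp only [val, Finset.sum_range_succ, List.take_length] at hs
      rw [Finset.sum_congr rfl fun i hi => by rw [hlt i hi]] at hs
      exact mul_left_cancel₀ (pow_ne_zero _ hF) (add_left_cancel hs)
    | product =>
      simp only [val, Finset.prod_range_succ, List.take_length] at hs
      rw [Finset.prod_congr rfl hlt] at hs
      exact mul_left_cancel₀ (Finset.prod_ne_zero_iff.2 fun i _ => (hF _ (hℓ _)).ne') hs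
    | classification => exact hs

theorem ValForm.val_nil_init {α : Type u} {F : ValForm} {ℓ : List α → ℚ}
    (h : F.Init (F.val ℓ [])) : F.Init (ℓ []) := by
  cases F <;> simp_all [ValForm.Init, ValForm.val]

/-- The label that `A` generates after reading `s`. -/
def Automaton.output {α : Type u} (A : Automaton.{u, v} α) (s : List α) : ℚ :=
  A.label (A.run s)

theorem Automaton.run_append {α : Type u} (A : Automaton.{u, v} α) (s t : List α) :
    A.run (s ++ t) = t.foldl A.next (A.run s) := by
  simp [run]

theorem Automaton.run_append_congr {α : Type u} (A : Automaton.{u, v} α) {s s' : List α}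
    (h : A.run s = A.run s') (t : List α) : A.run (s ++ t) = A.run (s' ++ t) := by
  rw [run_append, run_append, h]

theorem Automaton.output_append_congr {α : Type u} (A : Automaton.{u, v} α) {s s' : List α}
    (h : A.run s = A.run s') (t : List α) : A.output (s ++ t) = A.output (s' ++ t) :=
  congrArg A.label (A.run_append_congr h t)

/-! ### Tables and their hypotheses -/

namespace Table

variable {α : Type u} {O O' : Table α} {𝓔 : EqClasses α} {Λ : List α → ℚ}

/-- The set `S ∪ S·Σᴵ` of sequences that have a row in the table. -/
def rowIndex (O : Table α) : Set (List α) :=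
  {s | s ∈ O.S ∨ ∃ p ∈ O.S, ∃ σ : α, s = p ++ [σ]}

theorem mem_dom_iff {t : List α} : t ∈ O.dom ↔ ∃ s ∈ O.rowIndex, ∃ e ∈ O.E, t = s ++ e := by
  constructor
  · rintro ⟨s, hs, e, he, rfl | ⟨σ, rfl⟩⟩
    · exact ⟨s, Or.inl hs, e, he, rfl⟩
    · exact ⟨s ++ [σ], Or.inr ⟨s, hs, σ, rfl⟩, e, he, rfl⟩
  · rintro ⟨_, hs | ⟨s, hs, σ, rfl⟩, e, he, rfl⟩
    · exact ⟨_, hs, e, he, Or.inl rfl⟩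
    · exact ⟨s, hs, e, he, Or.inr ⟨σ, rfl⟩⟩

theorem append_mem_dom {s e : List α} (hs : s ∈ O.rowIndex) (he : e ∈ O.E) : s ++ e ∈ O.dom :=
  mem_dom_iff.2 ⟨s, hs, e, he, rfl⟩

theorem mem_dom_of_mem_S {s : List α} (hs : s ∈ O.S) : s ∈ O.dom := by
  simpa using append_mem_dom (Or.inl hs) O.nil_E

theorem finite_dom [Finite α] (O : Table α) : O.dom.Finite := by
  have h : O.rowIndex.Finite := by
    refine (O.finite_S.union (O.finite_S.image2 (fun p (σ : α) => p ++ [σ])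
      Set.finite_univ)).subset ?_
    rintro s (hs | ⟨p, hp, σ, rfl⟩)
    · exact Or.inl hs
    · exact Or.inr ⟨p, hp, σ, trivial, rfl⟩
  refine (h.image2 (· ++ ·) O.finite_E).subset fun t ht => ?_
  obtain ⟨s, hs, e, he, rfl⟩ := mem_dom_iff.1 ht
  exact ⟨s, hs, e, he, rfl⟩

theorem dom_mono (hS : O.S ⊆ O'.S) (hE : O.E ⊆ O'.E) : O.dom ⊆ O'.dom := by
  rintro t ⟨s, hs, e, he, h⟩
  exact ⟨s, hS hs, e, hE he, h⟩

theorem Expand.S_subset (h : O.Expand 𝓔 O') : O.S ⊆ O'.S := by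
  cases h with
  | close s σ hs hrow => exact Set.subset_union_left
  | separate s₁ s₂ σ e h₁ h₂ he hrow hne => exact subset_rfl

theorem Expand.E_subset (h : O.Expand 𝓔 O') : O.E ⊆ O'.E := by
  cases h with
  | close s σ hs hrow => exact subset_rfl
  | separate s₁ s₂ σ e h₁ h₂ he hrow hne => exact Set.subset_union_left

theorem row_eq_iff {s s' : List α} (hs : s ∈ O.rowIndex) (hs' : s' ∈ O.rowIndex) :
    O.row (classesOf O.dom Λ) s = O.row (classesOf O.dom Λ) s' ↔
      ∀ e ∈ O.E, Λ (s ++ e) = Λ (s' ++ e) := by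
  constructor
  · intro h e he
    have h' : s' ++ e ∈ O.row (classesOf O.dom Λ) s ⟨e, he⟩ := by
      rw [h]
      exact ⟨append_mem_dom hs' he, append_mem_dom hs' he, rfl⟩
    exact h'.2.2
  · intro h
    funext ⟨e, he⟩
    ext t
    simp [row, classesOf, append_mem_dom hs he, append_mem_dom hs' he, h e he]

theorem hypothesis_next (hc : O.Closed 𝓔) (hk : O.Consistent 𝓔)
    {q : (O.hypothesis 𝓔 Λ hc).Q} {s : List α} (hs : s ∈ O.S) (hq : q.1 = O.row 𝓔 s) (σ : α) :
    ((O.hypothesis 𝓔 Λ hc).next q σ).1 = O.row 𝓔 (s ++ [σ]) :=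
  hk _ q.2.choose_spec.1 _ hs (q.2.choose_spec.2.trans hq) σ

theorem hypothesis_run (hc : O.Closed 𝓔) (hk : O.Consistent 𝓔) {s : List α} (hs : s ∈ O.S) :
    ((O.hypothesis 𝓔 Λ hc).run s).1 = O.row 𝓔 s := by
  induction s using List.reverseRecOn with
  | nil => rfl
  | append_singleton s σ ih =>
    have hs' := O.prefix_S _ hs s (List.prefix_append _ _)
    rw [Automaton.run_append]
    exact hypothesis_next hc hk hs' (ih hs') σ

theorem hypothesis_run_of_mem_rowIndex (hc : O.Closed 𝓔) (hk : O.Consistent 𝓔) {s : List α}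
    (hs : s ∈ O.rowIndex) : ((O.hypothesis 𝓔 Λ hc).run s).1 = O.row 𝓔 s := by
  obtain hs | ⟨p, hp, σ, rfl⟩ := hs
  · exact hypothesis_run hc hk hs
  · rw [Automaton.run_append]
    exact hypothesis_next hc hk hp (hypothesis_run hc hk hp) σ

theorem hypothesis_label (hc : O.Closed (classesOf O.dom Λ))
    {q : (O.hypothesis (classesOf O.dom Λ) Λ hc).Q} {s : List α} (hs : s ∈ O.rowIndex)
    (hq : q.1 = O.row (classesOf O.dom Λ) s) :
    (O.hypothesis (classesOf O.dom Λ) Λ hc).label q = Λ s := by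
  have h := (row_eq_iff (Or.inl q.2.choose_spec.1) hs).1 (q.2.choose_spec.2.trans hq) [] O.nil_E
  rwa [List.append_nil, List.append_nil] at h

/-- Reading a column `e` from the row of `s` ends in a state labeled `Λ (s ++ e)`. Each letter of
`e` is read from a representative of the current row in `S`, and the rest of `e` is a column since
`E` is suffix-closed. -/
theorem hypothesis_label_foldl (hc : O.Closed (classesOf O.dom Λ))
    (hk : O.Consistent (classesOf O.dom Λ)) {e : List α} (he : e ∈ O.E)
    {q : (O.hypothesis (classesOf O.dom Λ) Λ hc).Q} {s : List α} (hs : s ∈ O.rowIndex)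
    (hq : q.1 = O.row (classesOf O.dom Λ) s) :
    (O.hypothesis (classesOf O.dom Λ) Λ hc).label
      (e.foldl (O.hypothesis (classesOf O.dom Λ) Λ hc).next q) = Λ (s ++ e) := by
  induction e generalizing q s with
  | nil => simpa using hypothesis_label hc hs hq
  | cons σ e ih =>
    obtain ⟨s', hs', hq'⟩ := q.2
    have h := ih (O.suffix_E _ he _ (List.suffix_cons _ _)) (Or.inr ⟨s', hs', σ, rfl⟩)
      (hypothesis_next hc hk hs' hq'.symm σ)
    rw [List.foldl_cons, h, List.append_assoc, List.singleton_append]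
    exact (row_eq_iff (Or.inl hs') hs).1 (hq'.trans hq) _ he

theorem hypothesis_output (hc : O.Closed (classesOf O.dom Λ))
    (hk : O.Consistent (classesOf O.dom Λ)) {t : List α} (ht : t ∈ O.dom) :
    (O.hypothesis (classesOf O.dom Λ) Λ hc).output t = Λ t := by
  obtain ⟨s, hs, e, he, rfl⟩ := mem_dom_iff.1 ht
  rw [Automaton.output, Automaton.run_append]
  exact hypothesis_label_foldl hc hk he hs (hypothesis_run_of_mem_rowIndex hc hk hs)

theorem finite_hypothesis (hc : O.Closed 𝓔) : Finite (O.hypothesis 𝓔 Λ hc).Q :=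
  (O.finite_S.image (O.row 𝓔)).to_subtype

/-- A hypothesis is no larger than any finite automaton with the same outputs: distinct rows are
told apart by the outputs on some column, so their access sequences reach distinct states. -/
theorem card_hypothesis_le (hc : O.Closed (classesOf O.dom Λ))
    (hk : O.Consistent (classesOf O.dom Λ)) (A : Automaton.{u, v} α) [Finite A.Q]
    (hA : ∀ t, A.output t = (O.hypothesis (classesOf O.dom Λ) Λ hc).output t) :
    Nat.card (O.hypothesis (classesOf O.dom Λ) Λ hc).Q ≤ Nat.card A.Q := by
  refine Nat.card_le_card_of_injective (fun r => A.run r.2.choose) fun r r' h => Subtype.ext ?_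
  rw [← r.2.choose_spec.2, ← r'.2.choose_spec.2]
  have hr := r.2.choose_spec.1
  have hr' := r'.2.choose_spec.1
  refine (row_eq_iff (Or.inl hr) (Or.inl hr')).2 fun e he => ?_
  rw [← hypothesis_output hc hk (append_mem_dom (Or.inl hr) he),
    ← hypothesis_output hc hk (append_mem_dom (Or.inl hr') he), ← hA, ← hA]
  exact A.output_append_congr h e

end Table

/-! ### Progress -/

/-- A state without successor is final. -/
theorem exists_eq_done_of_stuck {α : Type u} (P : Problem α) (σ : State α)
    (hσ : ∀ τ, ¬ Step P σ τ) : ∃ h, σ = .done h := by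
  cases σ with
  | done h => exact ⟨h, rfl⟩
  | fill M chain O tried B =>
    exfalso
    by_cases h : ∃ 𝓔, P.Selectable M chain O tried 𝓔
    · obtain ⟨𝓔, h⟩ := h
      exact hσ _ (.select h)
    · push Not at h
      cases chain with
      | cons n chain => exact hσ _ (.backtrack h)
      | nil =>
        by_cases ht : ∃ t, t ∉ O.dom
        · obtain ⟨t, ht, hmin⟩ := exists_minimalFor_of_wellFoundedLT (· ∉ O.dom) List.length ht
          replace hmin : ∀ t', t' ∉ O.dom → t.length ≤ t'.length := fun t' ht' =>
            (le_total t.length t'.length).elim id (hmin ht')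
          exact hσ _ (.deepen h (Or.inl ⟨t, ht, hmin, rfl⟩))
        · push Not at ht
          exact hσ _ (.deepen h (Or.inr ⟨ht, rfl⟩))
  | unified M chain O tried B 𝓔 =>
    exfalso
    by_cases hc : O.Closed 𝓔
    · by_cases hk : O.Consistent 𝓔
      · by_cases h : ∃ a, P.ValidHyp O 𝓔 B a
        · obtain ⟨a, h⟩ := h
          exact hσ _ (.sat hc hk h)
        · exact hσ _ (.unsat hc hk (not_exists.1 h))
      · unfold Table.Consistent at hk
        push Not at hk
        obtain ⟨s₁, h₁, s₂, h₂, hrow, σ, hne⟩ := hk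
        obtain ⟨⟨e, he⟩, hne⟩ := Function.ne_iff.1 hne
        exact hσ _ (.expand (.separate s₁ s₂ σ e h₁ h₂ he hrow hne))
    · unfold Table.Closed at hc
      push Not at hc
      obtain ⟨s, hs, σ, hrow⟩ := hc
      exact hσ _ (.expand (.close s σ hs hrow))
  | test M chain O tried B 𝓔 cex =>
    exfalso
    by_cases h : ∃ a, P.ValidHyp O 𝓔 B a
    · obtain ⟨a, h⟩ := h
      by_cases hV : a.Computes P.form P.V
      · exact hσ _ (.accept h hV)
      · obtain ⟨c, hc⟩ := not_forall.1 hV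
        exact hσ _ (.refute h hc)
    · exact hσ _ (.reject (not_exists.1 h))

/-! ### The true equivalence classes -/

section Target

variable {α : Type u} {P : Problem α} {A : Automaton.{u, w} α} {N K M : ℕ}
  {chain : List (Node α)} {O O' : Table α} {tried : Set (EqClasses α)}
  {B : List (ValueConstraint α)} {𝓔 : EqClasses α}

/-- `A` is a target automaton for `P`, every reachable state of `A` is reached by a sequence of
length at most `N`, and `K` is a budget at which the search is bound to succeed. -/
structure IsTarget (P : Problem α) (A : Automaton.{u, w} α) (N K : ℕ) : Prop where
  finite : Finite A.Q
  output_mem : ∀ s, A.output s ∈ P.Out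
  computes : A.Computes P.form P.V
  init : P.form.Init (P.V [])
  access : ∀ t, ∃ s, s.length ≤ N ∧ A.run s = A.run t
  words_lt : {t : List α | t.length ≤ N + 1}.ncard + 1 < K
  card_le : Nat.card A.Q ≤ K

theorem exists_access_bound (A : Automaton.{u, w} α) [Finite A.Q] :
    ∃ N, ∀ t, ∃ s : List α, s.length ≤ N ∧ A.run s = A.run t := by
  have hfin : (Set.range A.run).Finite := Set.toFinite _
  choose! f hf using fun q (hq : q ∈ Set.range A.run) => hq
  obtain ⟨N, hN⟩ := (hfin.image fun q => (f q).length).bddAbove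
  exact ⟨N, fun t => ⟨f (A.run t), hN ⟨_, ⟨t, rfl⟩, rfl⟩, hf _ ⟨t, rfl⟩⟩⟩

/-- The equivalence classes of the variables of `O` under the labels of `A`. -/
def trueClasses (A : Automaton.{u, w} α) (O : Table α) : EqClasses α :=
  classesOf O.dom A.output

/-- Every reachable state of `A` is reached by a sequence in `S`. -/
def Covers (A : Automaton.{u, w} α) (O : Table α) : Prop :=
  ∀ t, ∃ s ∈ O.S, A.run s = A.run t

/-- The row of `s` over the columns `E`, filled in with the labels of `A`. -/
noncomputable def trueRow (A : Automaton.{u, w} α) (E : Set (List α)) (s : List α) :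
    List α → ℚ :=
  E.indicator fun e => A.output (s ++ e)

theorem trueRow_congr (E : Set (List α)) {s s' : List α} (h : A.run s = A.run s') :
    trueRow A E s = trueRow A E s' := by
  unfold trueRow
  simp only [A.output_append_congr h]

theorem card_trueRow_le [Finite A.Q] (E S : Set (List α)) :
    (trueRow A E '' S).ncard ≤ Nat.card A.Q := by
  have h : (A.run '' S).ncard ≤ Nat.card A.Q := Set.ncard_le_card _
  refine le_trans ?_ h
  choose! f hf using fun q (hq : q ∈ A.run '' S) => hq
  have : trueRow A E '' S ⊆ (fun q => trueRow A E (f q)) '' (A.run '' S) := by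
    rintro _ ⟨s, hs, rfl⟩
    exact ⟨A.run s, ⟨s, hs, rfl⟩, trueRow_congr E (hf _ ⟨s, hs, rfl⟩).2⟩
  exact (Set.ncard_le_ncard this).trans (Set.ncard_image_le (Set.toFinite _))

theorem row_trueClasses_congr {s s' : List α} (hs : s ∈ O.rowIndex) (hs' : s' ∈ O.rowIndex)
    (h : A.run s = A.run s') : O.row (trueClasses A O) s = O.row (trueClasses A O) s' :=
  (Table.row_eq_iff hs hs').2 fun e _ => A.output_append_congr h e

/-- Repairing a defect of a table that covers `A` and is unified by the true classes yields a new
true row: the table is already closed, so the defect is an inconsistency, and the new column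
separates two rows that were equal. -/
theorem card_trueRow_lt_of_expand (hcov : Covers A O) (h : O.Expand (trueClasses A O) O') :
    (trueRow A O.E '' O.S).ncard < (trueRow A O'.E '' O'.S).ncard := by
  cases h with
  | close s σ hs hrow =>
    obtain ⟨s', hs', h'⟩ := hcov (s ++ [σ])
    exact absurd (row_trueClasses_congr (Or.inl hs') (Or.inr ⟨s, hs, σ, rfl⟩) h') (hrow s' hs')
  | separate s₁ s₂ σ e h₁ h₂ he hrow hne =>
    set E' := (O.addSuffix σ e he).E with hE'
    have hsub : O.E ⊆ E' := Set.subset_union_left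
    have hmem : σ :: e ∈ E' := Or.inr (List.prefix_refl _)
    have hres : ∀ s, O.E.indicator (trueRow A E' s) = trueRow A O.E s := fun s => by
      rw [trueRow, Set.indicator_indicator, Set.inter_eq_left.2 hsub, trueRow]
    have himg : O.E.indicator '' (trueRow A E' '' O.S) = trueRow A O.E '' O.S := by
      rw [Set.image_image]
      simp only [hres]
    have hfin : (trueRow A E' '' O.S).Finite := O.finite_S.image _
    change (trueRow A O.E '' O.S).ncard < (trueRow A E' '' O.S).ncard
    rw [← himg]
    refine lt_of_le_of_ne (Set.ncard_image_le hfin) fun heq => ?_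
    have hinj := Set.injOn_of_ncard_image_eq heq hfin
    have hold : trueRow A O.E s₁ = trueRow A O.E s₂ := by
      have := (Table.row_eq_iff (Or.inl h₁) (Or.inl h₂)).1 hrow
      funext x
      by_cases hx : x ∈ O.E
      · simpa [trueRow, hx] using this x hx
      · simp [trueRow, hx]
    have hnew := hinj ⟨s₁, h₁, rfl⟩ ⟨s₂, h₂, rfl⟩ (by rw [hres, hres, hold])
    have hval : A.output (s₁ ++ σ :: e) = A.output (s₂ ++ σ :: e) := by
      simpa [trueRow, hmem] using congrFun hnew (σ :: e)
    apply hne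
    ext t
    have h₁' := Table.append_mem_dom (O := O) (Or.inr ⟨s₁, h₁, σ, rfl⟩) he
    have h₂' := Table.append_mem_dom (O := O) (Or.inr ⟨s₂, h₂, σ, rfl⟩) he
    simp only [List.append_assoc, List.singleton_append] at h₁' h₂'
    simp [Table.row, trueClasses, classesOf, h₁', h₂', hval]

theorem IsTarget.solves (hA : IsTarget P A N K) (O : Table α) : P.Solves O A.output := by
  have hV : P.form.val A.output = P.V := funext hA.computes
  exact ⟨fun t _ => hA.output_mem t, ValForm.val_nil_init (hV ▸ hA.init), by simp [hV]⟩

/-- A closed and consistent table that covers `A` and is unified by the true classes gives, with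
the true labels, a correct hypothesis: the state reached by `t` is the row of any sequence in `S`
that reaches the same state of `A`. -/
theorem IsTarget.hypothesis_computes (hA : IsTarget P A N K) (hcov : Covers A O)
    (hc : O.Closed (trueClasses A O)) (hk : O.Consistent (trueClasses A O)) :
    (O.hypothesis (trueClasses A O) A.output hc).Computes P.form P.V := by
  have hrun : ∀ t s, s ∈ O.S → A.run s = A.run t →
      ((O.hypothesis (trueClasses A O) A.output hc).run t).1 = O.row (trueClasses A O) s := by
    intro t
    induction t using List.reverseRecOn with
    | nil => exact fun s hs h => row_trueClasses_congr (Or.inl O.nil_S) (Or.inl hs) h.symm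
    | append_singleton t σ ih =>
      intro s hs h
      obtain ⟨s', hs', h'⟩ := hcov t
      rw [Automaton.run_append]
      refine (Table.hypothesis_next hc hk hs' (ih s' hs' h') σ).trans ?_
      exact row_trueClasses_congr (Or.inr ⟨s', hs', σ, rfl⟩) (Or.inl hs)
        ((A.run_append_congr h' [σ]).trans h.symm)
  have hout : (O.hypothesis (trueClasses A O) A.output hc).output = A.output := by
    funext t
    obtain ⟨s, hs, h⟩ := hcov t
    refine (Table.hypothesis_label hc (Or.inl hs) (hrun t s hs h)).trans ?_
    exact congrArg A.label h
  intro s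
  rw [← hA.computes s]
  change P.form.val (O.hypothesis (trueClasses A O) A.output hc).output s = P.form.val A.output s
  rw [hout]

/-! ### An invariant of all runs -/

/-- All equivalence class sets of the chain are the true ones. -/
def TrueChain (A : Automaton.{u, w} α) (chain : List (Node α)) : Prop :=
  ∀ n ∈ chain, n.classes = trueClasses A n.table

/-- Invariant of a table `O` with its set `tried` of ruled out equivalence class sets, situated
above `chain`. Once the budget reaches `K`, the table covers `A`, and above a chain of true classes
it has more true rows than the chain has elements and its true classes are not ruled out. -/
structure Level (A : Automaton.{u, w} α) (K M : ℕ) (chain : List (Node α)) (O : Table α)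
    (tried : Set (EqClasses α)) : Prop where
  tried_subset : ∀ 𝓔 ∈ tried, 𝓔 ⊆ O.dom ×ˢ O.dom
  length_le : ∀ e ∈ O.E, e.length ≤ chain.length
  covers : K ≤ M → Covers A O
  length_lt_card : K ≤ M → TrueChain A chain → chain.length < (trueRow A O.E '' O.S).ncard
  not_mem_tried : K ≤ M → TrueChain A chain → trueClasses A O ∉ tried

/-- Invariant of a chain below the table `O`. Each deepening so far has provided the root table with
one more sequence of length at most `N + 1`, until all of them have a variable. -/
def Stack (A : Automaton.{u, w} α) (N K M : ℕ) : List (Node α) → Table α → Prop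
  | [], O => M ≤ ({t | t.length ≤ N + 1} ∩ O.dom).ncard + 1 ∨ {t | t.length ≤ N + 1} ⊆ O.dom
  | n :: chain, O => n.table.dom ⊆ O.dom ∧ n.classes ⊆ n.table.dom ×ˢ n.table.dom ∧
      n.classes ∉ n.tried ∧ Level A K M chain n.table n.tried ∧ Stack A N K M chain n.table

/-- The part of the invariant that concerns all control states before termination. -/
structure Sound (P : Problem α) (A : Automaton.{u, w} α) (N K M : ℕ) (chain : List (Node α))
    (O : Table α) (tried : Set (EqClasses α)) (B : List (ValueConstraint α)) : Prop where
  le : M ≤ K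
  length_le : chain.length ≤ M
  holds : ∀ b ∈ B, b.Holds P.V
  stack : Stack A N K M chain O
  level : Level A K M chain O tried

/-- The invariant of the control states. -/
def Invariant (P : Problem α) (A : Automaton.{u, w} α) (N K : ℕ) : State α → Prop
  | .fill M chain O tried B => Sound P A N K M chain O tried B
  | .unified M chain O tried B 𝓔 => Sound P A N K M chain O tried B ∧ chain.length < M ∧
      𝓔 ⊆ O.dom ×ˢ O.dom ∧ 𝓔 ∉ tried
  | .test M chain O tried B 𝓔 cex => Sound P A N K M chain O tried B ∧ chain.length < M ∧
      𝓔 ⊆ O.dom ×ˢ O.dom ∧ 𝓔 ∉ tried ∧ O.Closed 𝓔 ∧ O.Consistent 𝓔 ∧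
      (cex = [] → ∃ a, P.ValidHyp O 𝓔 B a)
  | .done h => ∃ O 𝓔 B, O.Closed 𝓔 ∧ O.Consistent 𝓔 ∧ P.ValidHyp O 𝓔 B h ∧
      h.Computes P.form P.V

theorem classesOf_subset (D : Set (List α)) (Λ : List α → ℚ) : classesOf D Λ ⊆ D ×ˢ D :=
  fun _ hp => ⟨hp.1, hp.2.1⟩

theorem Stack.mono (h : Stack A N K M chain O) [Finite α] (hd : O.dom ⊆ O'.dom) :
    Stack A N K M chain O' := by
  cases chain with
  | nil =>
    refine Or.imp (fun h => h.trans ?_) (fun h => h.trans hd) h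
    gcongr
    exact O'.finite_dom.subset Set.inter_subset_right
  | cons n chain => exact ⟨h.1.trans hd, h.2⟩

/-- At a root table, `E = {ε}`, so a sequence of length `N + 1` with a variable has all its proper
prefixes in `S`. -/
theorem IsTarget.covers_of_subset (hA : IsTarget P A N K) (hE : ∀ e ∈ O.E, e.length ≤ 0)
    (h : {t | t.length ≤ N + 1} ⊆ O.dom) : Covers A O := by
  intro t
  obtain ⟨s, hs, hrun⟩ := hA.access t
  refine ⟨s, ?_, hrun⟩
  rcases s.eq_nil_or_concat with rfl | ⟨_, σ, _⟩
  · exact O.nil_S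
  · have hmem : s ++ [σ] ∈ O.dom := h (by simpa using hs)
    obtain ⟨p, hp, e, he, heq⟩ := Table.mem_dom_iff.1 hmem
    obtain rfl := List.length_eq_zero_iff.1 (Nat.le_zero.1 (hE e he))
    rw [List.append_nil] at heq
    rcases hp with hp | ⟨p', hp', τ, rfl⟩
    · exact O.prefix_S p hp s (heq ▸ List.prefix_append _ _)
    · rwa [List.append_inj_left' heq rfl]

theorem IsTarget.covers_of_stack (hA : IsTarget P A N K) [Finite α] (hKM : K ≤ M)
    (hE : ∀ e ∈ O.E, e.length ≤ 0) (h : Stack A N K M [] O) : Covers A O := by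
  refine hA.covers_of_subset hE (h.resolve_left fun hM => ?_)
  have := Set.ncard_le_ncard (Set.inter_subset_left : {t : List α | t.length ≤ N + 1} ∩ O.dom ⊆ _)
    (List.finite_length_le α (N + 1))
  have := hA.words_lt
  omega

theorem Stack.deepen [Finite α] (h : Stack A N K M [] O) (hO : O.ForceExpand O') :
    Stack A N K (M + 1) [] O' := by
  rcases hO with ⟨t, ht, hmin, rfl⟩ | ⟨hall, rfl⟩
  · have hd : O.dom ⊆ (O.addPrefixes [t]).dom :=
      Table.dom_mono Set.subset_union_left subset_rfl
    by_cases hW : {t | t.length ≤ N + 1} ⊆ O.dom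
    · exact Or.inr (hW.trans hd)
    · obtain ⟨x, hx, hxd⟩ := Set.not_subset.1 hW
      have hlt : ({t | t.length ≤ N + 1} ∩ O.dom).ncard <
          ({t | t.length ≤ N + 1} ∩ (O.addPrefixes [t]).dom).ncard := by
        refine Set.ncard_lt_ncard ⟨Set.inter_subset_inter_right _ hd, fun hsub => ?_⟩
          ((List.finite_length_le α (N + 1)).subset Set.inter_subset_left)
        refine ht (hsub (a := t) ⟨(hmin x hxd).trans hx, Table.mem_dom_of_mem_S (Or.inr ?_)⟩).2
        exact ⟨t, by simp, List.prefix_refl _⟩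
      have := h.resolve_right hW
      exact Or.inl (by omega)
  · exact Or.inr fun t _ => hall t

/-- A new table at an unchanged chain, after `𝓔` has been ruled out. True classes of a larger set of
variables differ from all equivalence class sets ruled out for the old table. -/
theorem Level.insert (h : Level A K M chain O tried) (hS : O.S ⊆ O'.S) (hE : O'.E = O.E)
    (h𝓔 : 𝓔 ⊆ O.dom ×ˢ O.dom) (hne : K ≤ M → TrueChain A chain → 𝓔 ≠ trueClasses A O) :
    Level A K M chain O' (insert 𝓔 tried) := by
  have hd : O.dom ⊆ O'.dom := Table.dom_mono hS hE.ge
  have hsub : ∀ 𝓕 ∈ Insert.insert 𝓔 tried, 𝓕 ⊆ O.dom ×ˢ O.dom := by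
    rintro 𝓕 (rfl | h𝓕)
    · exact h𝓔
    · exact h.tried_subset 𝓕 h𝓕
  refine ⟨fun 𝓕 h𝓕 => (hsub 𝓕 h𝓕).trans (Set.prod_mono hd hd), hE ▸ h.length_le,
    fun hK t => ?_, fun hK hT => ?_, fun hK hT hmem => ?_⟩
  · obtain ⟨s, hs, hrun⟩ := h.covers hK t
    exact ⟨s, hS hs, hrun⟩
  · rw [hE]
    exact (h.length_lt_card hK hT).trans_le
      (Set.ncard_le_ncard (Set.image_mono hS) (O'.finite_S.image _))
  · have hdom : O'.dom = O.dom :=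
      Set.Subset.antisymm (fun t ht => (hsub _ hmem (a := (t, t)) ⟨ht, ht, rfl⟩).1) hd
    have heq : trueClasses A O' = trueClasses A O := by rw [trueClasses, hdom, trueClasses]
    rw [heq] at hmem
    exact hmem.elim (fun h' => hne hK hT h'.symm) (h.not_mem_tried hK hT)

theorem Level.expand (h : Level A K M chain O tried) (hO : O.Expand 𝓔 O') :
    Level A K M (⟨O, tried, 𝓔⟩ :: chain) O' ∅ := by
  refine ⟨by simp, fun e he => ?_, fun hK t => ?_, fun hK hT => ?_, by simp⟩
  · cases hO with
    | close s σ hs hrow => exact (h.length_le e he).trans (Nat.le_succ _)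
    | separate s₁ s₂ σ e' h₁ h₂ he' hrow hne =>
      rcases he with he | he
      · exact (h.length_le e he).trans (Nat.le_succ _)
      · exact (List.IsPrefix.length_le he).trans (Nat.succ_le_succ (h.length_le e' he'))
  · obtain ⟨s, hs, hrun⟩ := h.covers hK t
    exact ⟨s, hO.S_subset hs, hrun⟩
  · obtain rfl : 𝓔 = trueClasses A O := hT _ (List.mem_cons_self ..)
    have h₁ := h.length_lt_card hK fun n hn => hT n (List.mem_cons_of_mem _ hn)
    have h₂ := card_trueRow_lt_of_expand (h.covers hK) hO
    rw [List.length_cons]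
    omega

/-- With budget `K`, the true classes can be selected above a chain of true classes. -/
theorem IsTarget.selectable (hA : IsTarget P A N K) (hK : K ≤ M)
    (hl : Level A K M chain O tried) (hs : Stack A N K M chain O) (hT : TrueChain A chain) :
    P.Selectable M chain O tried (trueClasses A O) := by
  have := hA.finite
  refine ⟨((hl.length_lt_card hK hT).trans_le (card_trueRow_le _ _)).trans_le
    (hA.card_le.trans hK), ⟨A.output, hA.solves O, rfl⟩, ?_, hl.not_mem_tried hK hT⟩
  cases chain with
  | nil => trivial
  | cons n chain =>
    intro s h_s t h_t
    rw [hT n (List.mem_cons_self ..)]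
    simp [trueClasses, classesOf, h_s, h_t, hs.1 h_s, hs.1 h_t]

theorem IsTarget.lt_of_not_selectable (hA : IsTarget P A N K) (hs : Sound P A N K M [] O tried B)
    (h : ∀ 𝓔, ¬ P.Selectable M [] O tried 𝓔) : M < K :=
  lt_of_not_ge fun hK => h _ (hA.selectable hK hs.level hs.stack (by simp [TrueChain]))

/-- With budget `K`, the true classes above a chain of true classes cannot be ruled out by the
feedback. -/
theorem IsTarget.ne_trueClasses (hA : IsTarget P A N K) (hs : Sound P A N K M chain O tried B)
    (hc : O.Closed 𝓔) (hk : O.Consistent 𝓔) (h : ∀ a, ¬ P.ValidHyp O 𝓔 B a) (hK : K ≤ M) :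
    𝓔 ≠ trueClasses A O := by
  rintro rfl
  refine h _ ⟨hc, A.output, hA.solves O, rfl, rfl, fun b hb => ?_⟩
  rw [show (O.hypothesis (trueClasses A O) A.output hc).eval P.form = P.V from
    funext (hA.hypothesis_computes (hs.level.covers hK) hc hk)]
  exact hs.holds b hb

theorem Problem.respond_holds {f : List α → ℚ} {c : List α} (h : f c ≠ P.V c) :
    (P.respond f c).Holds P.V := by
  unfold Problem.respond
  cases P.feedback
  · exact rfl
  · exact h.symm

theorem Problem.not_respond_holds {f : List α → ℚ} {c : List α} (h : f c ≠ P.V c) :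
    ¬ (P.respond f c).Holds f := by
  unfold Problem.respond
  cases P.feedback
  · exact h
  · exact fun h' => h' rfl

theorem IsTarget.invariant_initial (hA : IsTarget P A N K) [Finite α] :
    Invariant P A N K State.initial := by
  have := hA.words_lt
  have hE : ∀ e ∈ (Table.initial : Table α).E, e.length ≤ 0 := by rintro e rfl; exact le_rfl
  exact ⟨by omega, Nat.zero_le _, by simp, Or.inl (by omega), by simp, hE,
    fun hK => absurd hK (by omega), fun hK => absurd hK (by omega), by simp⟩

theorem IsTarget.invariant_step (hA : IsTarget P A N K) [Finite α] {σ τ : State α}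
    (hσ : Invariant P A N K σ) (h : Step P σ τ) : Invariant P A N K τ := by
  cases h with
  | select h =>
    obtain ⟨hlen, ⟨Λ, -, rfl⟩, -, htried⟩ := h
    exact ⟨hσ, hlen, classesOf_subset _ _, htried⟩
  | @backtrack M n chain O tried B h =>
    obtain ⟨hle, hlen, hB, ⟨hd, hcls, hntried, hlev, hst⟩, hlev'⟩ := hσ
    refine ⟨hle, (Nat.le_succ _).trans hlen, hB, hst,
      hlev.insert subset_rfl rfl hcls fun hK hT heq => ?_⟩
    refine h _ (hA.selectable hK hlev' ⟨hd, hcls, hntried, hlev, hst⟩ ?_)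
    rintro m (_ | ⟨_, hm⟩)
    exacts [heq, hT m hm]
  | @deepen M O O' tried B h hO =>
    have hlt := hA.lt_of_not_selectable hσ h
    have hst : Stack A N K (M + 1) [] O' := hσ.stack.deepen hO
    have hE : ∀ e ∈ O'.E, e.length ≤ 0 := by
      rcases hO with ⟨t, -, -, rfl⟩ | ⟨-, rfl⟩ <;> exact hσ.level.length_le
    refine ⟨hlt, Nat.zero_le _, hσ.holds, hst, by simp, hE,
      fun hK => hA.covers_of_stack hK hE hst, fun _ _ => ?_, by simp⟩
    exact (Set.ncard_pos (O'.finite_S.image _)).2 ⟨_, [], O'.nil_S, rfl⟩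
  | expand h =>
    obtain ⟨hs, hlen, hcls, htried⟩ := hσ
    exact ⟨hs.le, hlen, hs.holds, ⟨Table.dom_mono h.S_subset h.E_subset, hcls, htried, hs.level,
      hs.stack⟩, hs.level.expand h⟩
  | unsat hc hk h =>
    obtain ⟨hs, hlen, hcls, htried⟩ := hσ
    exact ⟨hs.le, hs.length_le, hs.holds, hs.stack,
      hs.level.insert subset_rfl rfl hcls fun hK _ => hA.ne_trueClasses hs hc hk h hK⟩
  | sat hc hk h =>
    obtain ⟨hs, hlen, hcls, htried⟩ := hσ
    exact ⟨hs, hlen, hcls, htried, hc, hk, fun _ => ⟨_, h⟩⟩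
  | accept h hV =>
    obtain ⟨-, -, -, -, hc, hk, -⟩ := hσ
    exact ⟨_, _, _, hc, hk, h, hV⟩
  | refute h hV =>
    obtain ⟨hs, hlen, hcls, htried, hc, hk, -⟩ := hσ
    refine ⟨⟨hs.le, hs.length_le, ?_, hs.stack, hs.level⟩, hlen, hcls, htried, hc, hk, by simp⟩
    rintro b (_ | ⟨_, hb⟩)
    exacts [Problem.respond_holds hV, hs.holds b hb]
  | reject h =>
    obtain ⟨hs, hlen, hcls, htried, hc, hk, -⟩ := hσ
    exact ⟨hs.le, hs.length_le, hs.holds,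
      hs.stack.mono (Table.dom_mono Set.subset_union_left subset_rfl),
      hs.level.insert Set.subset_union_left rfl hcls
        fun hK _ => hA.ne_trueClasses hs hc hk h hK⟩

/-! ### A decreasing measure -/

/-- The automaton with states `X` and output letters in `Out`. -/
def lettered {Out : Set ℚ} {X : Type u} (d : X × (X → α → X) × (X → Out)) : Automaton.{u, u} α :=
  ⟨X, d.1, d.2.1, fun x => d.2.2 x⟩

/-- The valuations of automata whose states are functions from the sequences of length at most `K`
to output letters. Up to isomorphism these include all hypotheses from tables whose columns have
length at most `K`, a row being given by its labels. -/
def boundedEvals (P : Problem α) (K : ℕ) : Set (List α → ℚ) :=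
  Set.range fun d : ({e : List α // e.length ≤ K} → P.Out) ×
      (({e : List α // e.length ≤ K} → P.Out) → α → ({e : List α // e.length ≤ K} → P.Out)) ×
      (({e : List α // e.length ≤ K} → P.Out) → P.Out) => (lettered d).eval P.form

theorem finite_boundedEvals [Finite α] (hP : P.Out.Finite) (K : ℕ) :
    (boundedEvals P K).Finite := by
  have := hP.to_subtype
  have : Finite {e : List α // e.length ≤ K} := (List.finite_length_le α K).to_subtype
  exact Set.finite_range _

/-- States may be renamed along an injection into a larger type. -/
theorem exists_eval_lettered_eq {Out : Set ℚ} {X : Type u} (h : Automaton.{u, u} α)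
    (hout : ∀ q, h.label q ∈ Out) (f : h.Q → X) (hf : f.Injective) (F : ValForm) :
    ∃ d : X × (X → α → X) × (X → Out), (lettered d).eval F = h.eval F := by
  have : Nonempty h.Q := ⟨h.start⟩
  have hinv := Function.leftInverse_invFun hf
  refine ⟨⟨f h.start, fun x σ => f (h.next (Function.invFun f x) σ),
    fun x => ⟨h.label (Function.invFun f x), hout _⟩⟩, ?_⟩
  set A : Automaton.{u, u} α := lettered ⟨f h.start, fun x σ =>
    f (h.next (Function.invFun f x) σ), fun x => (⟨h.label (Function.invFun f x), hout _⟩ : Out)⟩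
  have hrun : ∀ s, A.run s = f (h.run s) := by
    intro s
    induction s using List.reverseRecOn with
    | nil => rfl
    | append_singleton s σ ih =>
      rw [A.run_append, h.run_append, ih]
      change f (h.next (Function.invFun f (f (h.run s))) σ) = f (h.next (h.run s) σ)
      rw [hinv]
  have hlab : (fun p => A.label (A.run p)) = fun p => h.label (h.run p) := by
    funext p
    rw [hrun]
    change h.label (Function.invFun f (f (h.run p))) = _
    rw [hinv]
  funext s
  unfold Automaton.eval
  rw [hlab]

theorem Problem.ValidHyp.label_mem {h : Automaton.{u, u} α} (hh : P.ValidHyp O 𝓔 B h) (q : h.Q) :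
    h.label q ∈ P.Out := by
  obtain ⟨hc, Λ, hΛ, -, rfl, -⟩ := hh
  exact hΛ.1 _ (Table.mem_dom_of_mem_S q.2.choose_spec.1)

theorem Problem.ValidHyp.eval_mem {h : Automaton.{u, u} α} (hh : P.ValidHyp O 𝓔 B h)
    (hE : ∀ e ∈ O.E, e.length ≤ K) : h.eval P.form ∈ boundedEvals P K := by
  classical
  have hout := hh.label_mem
  obtain ⟨hc, Λ, hΛ, rfl, rfl, -⟩ := hh
  refine exists_eval_lettered_eq (X := {e : List α // e.length ≤ K} → P.Out) _ hout (fun r e =>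
    if he : e.1 ∈ O.E then
      ⟨Λ (r.2.choose ++ e.1), hΛ.1 _ (Table.append_mem_dom (Or.inl r.2.choose_spec.1) he)⟩
    else ⟨Λ [], hΛ.1 _ (Table.mem_dom_of_mem_S O.nil_S)⟩) (fun r r' hr => Subtype.ext ?_) _
  rw [← r.2.choose_spec.2, ← r'.2.choose_spec.2]
  refine (Table.row_eq_iff (Or.inl r.2.choose_spec.1) (Or.inl r'.2.choose_spec.1)).2
    fun e he => ?_
  simpa [he] using congrFun hr ⟨e, hE e he⟩

/-- The number of valuations of bounded hypotheses that satisfy the feedback constraints `B`. -/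
noncomputable def live (P : Problem α) (K : ℕ) (B : List (ValueConstraint α)) : ℕ :=
  {f ∈ boundedEvals P K | ∀ b ∈ B, b.Holds f}.ncard

theorem live_cons_lt [Finite α] (hP : P.Out.Finite) {h : Automaton.{u, u} α}
    (hh : P.ValidHyp O 𝓔 B h) (hE : ∀ e ∈ O.E, e.length ≤ K) {c : List α}
    (hc : h.eval P.form c ≠ P.V c) :
    live P K (P.respond (h.eval P.form) c :: B) < live P K B := by
  have hB : ∀ b ∈ B, b.Holds (h.eval P.form) := by
    obtain ⟨-, -, -, -, -, hB⟩ := hh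
    exact hB
  refine Set.ncard_lt_ncard ⟨fun f hf => ⟨hf.1, fun b hb => hf.2 b (List.mem_cons_of_mem _ hb)⟩,
    fun hsub => ?_⟩ ((finite_boundedEvals hP K).subset (Set.sep_subset _ _))
  exact Problem.not_respond_holds hc
    ((hsub (a := h.eval P.form) ⟨hh.eval_mem hE, hB⟩).2 _ (List.mem_cons_self ..))

/-- The number of sets of pairs of variables of `O` that are not ruled out. -/
noncomputable def remaining (O : Table α) (tried : Set (EqClasses α)) : ℕ :=
  (𝒫 (O.dom ×ˢ O.dom) \ tried).ncard

theorem remaining_insert_lt [Finite α] (h : 𝓔 ⊆ O.dom ×ˢ O.dom) (h' : 𝓔 ∉ tried) :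
    remaining O (insert 𝓔 tried) < remaining O tried := by
  refine Set.ncard_lt_ncard ⟨Set.sdiff_subset_sdiff_right (Set.subset_insert _ _), fun hsub => ?_⟩
    (Set.Finite.subset (O.finite_dom.prod O.finite_dom).finite_subsets Set.sdiff_subset)
  exact (hsub (a := 𝓔) ⟨h, h'⟩).2 (Set.mem_insert _ _)

/-- Rank of each level of a chain, starting from the root. -/
noncomputable def chainRank : List (Node α) → ℕ → ℕ
  | [] => 0
  | n :: chain => Function.update (chainRank chain) chain.length (4 * remaining n.table n.tried)

/-- Rank of a control state, to be compared lexicographically: the budget that is left, the number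
of hypotheses that feedback may still exclude together with a bit `r` for pending counterexamples,
and the numbers of equivalence class sets that remain at each level of the chain, from the root
upwards, with a digit `d` for the phase of the work at the current level. -/
noncomputable def rank (P : Problem α) (K M : ℕ) (chain : List (Node α)) (O : Table α)
    (tried : Set (EqClasses α)) (B : List (ValueConstraint α)) (r d : ℕ) : ℕ → ℕ
  | 0 => K - M
  | 1 => 2 * live P K B + r
  | k + 2 => Function.update (chainRank chain) chain.length (4 * remaining O tried + d) k

/-- The rank of each control state. The digits make `select`, `sat` and `expand` decrease the rank:
an element of the chain has digit `0`, the phases `test`, `unified` and `fill` of the current level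
have `1`, `2` and `3`, which is less than the weight `4` of one ruled out equivalence class set. The
weight `2` of a hypothesis likewise outweighs the bit for pending counterexamples. A final state has
no successor, so its rank is immaterial. -/
noncomputable def State.rank (P : Problem α) (K : ℕ) : State α → ℕ → ℕ
  | .fill M chain O tried B => Quintic.rank P K M chain O tried B 0 3
  | .unified M chain O tried B _ => Quintic.rank P K M chain O tried B 0 2
  | .test M chain O tried B _ [] => Quintic.rank P K M chain O tried B 0 1
  | .test M chain O tried B _ (_ :: _) => Quintic.rank P K M chain O tried B 1 1
  | .done _ => 0

/-- Lexicographic comparison of the first `n` terms of two sequences. -/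
def LexLT (n : ℕ) (f g : ℕ → ℕ) : Prop :=
  ∃ i < n, (∀ j < i, f j = g j) ∧ f i < g i

theorem wellFounded_lexLT (n : ℕ) : WellFounded (LexLT n) := by
  have h : WellFounded (Pi.Lex (· < ·) fun {_ : Fin n} => ((· < ·) : ℕ → ℕ → Prop)) :=
    Pi.Lex.wellFounded _ fun _ => wellFounded_lt
  refine Subrelation.wf (fun {f g} hfg => ?_)
    (InvImage.wf (fun (f : ℕ → ℕ) (i : Fin n) => f i) h)
  obtain ⟨i, hi, heq, hlt⟩ := hfg
  exact ⟨⟨i, hi⟩, fun j hj => heq j hj, hlt⟩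

/-- Comparison of ranks at the level of index `k`. -/
theorem lexLT_rank {n k M : ℕ} {chain chain' : List (Node α)} {O O' : Table α}
    {tried tried' : Set (EqClasses α)} {B : List (ValueConstraint α)} {d d' : ℕ} (hk : k + 2 < n)
    (heq : ∀ j < k, Function.update (chainRank chain') chain'.length
        (4 * remaining O' tried' + d') j =
      Function.update (chainRank chain) chain.length (4 * remaining O tried + d) j)
    (hlt : Function.update (chainRank chain') chain'.length (4 * remaining O' tried' + d') k <
      Function.update (chainRank chain) chain.length (4 * remaining O tried + d) k) :
    LexLT n (rank P K M chain' O' tried' B 0 d') (rank P K M chain O tried B 0 d) := by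
  refine ⟨k + 2, hk, fun j hj => ?_, hlt⟩
  match j with
  | 0 => rfl
  | 1 => rfl
  | j + 2 => exact heq j (by omega)

theorem lexLT_rank_of_lt {n M : ℕ} {chain : List (Node α)} {O O' : Table α}
    {tried tried' : Set (EqClasses α)} {B : List (ValueConstraint α)} {d d' : ℕ}
    (hk : chain.length + 2 < n)
    (hlt : 4 * remaining O' tried' + d' < 4 * remaining O tried + d) :
    LexLT n (rank P K M chain O' tried' B 0 d') (rank P K M chain O tried B 0 d) := by
  refine lexLT_rank hk (fun j hj => ?_) (by simpa using hlt)
  rw [Function.update_of_ne hj.ne, Function.update_of_ne hj.ne]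

/-- Each step of a run that does not return decreases the rank. Rejection, which may enlarge the
table, is preceded by a refutation, and there are finitely many of those since each excludes a
bounded hypothesis; the steps in between perform a depth-first search of bounded depth. -/
theorem IsTarget.lexLT_of_step (hA : IsTarget P A N K) [Finite α] (hP : P.Out.Finite)
    {σ τ : State α} (hσ : Invariant P A N K σ) (h : Step P σ τ) (hτ : ∀ a, τ ≠ .done a) :
    LexLT (K + 3) (τ.rank P K) (σ.rank P K) := by
  cases h with
  | @select M chain O tried B 𝓔 h =>
    have := hσ.le
    have := hσ.length_le
    exact lexLT_rank_of_lt (by omega) (by omega)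
  | @backtrack M n chain O tried B h =>
    obtain ⟨hle, hlen, hB, ⟨hd, hcls, hntried, hlev, hst⟩, hlev'⟩ := hσ
    rw [List.length_cons] at hlen
    have := remaining_insert_lt hcls hntried
    refine lexLT_rank (k := chain.length) (by omega) (fun j hj => ?_) ?_
    · rw [Function.update_of_ne hj.ne, Function.update_of_ne (by rw [List.length_cons]; omega),
        chainRank, Function.update_of_ne hj.ne]
    · rw [Function.update_self, Function.update_of_ne (by simp), chainRank, Function.update_self]
      omega
  | @deepen M O O' tried B h hO =>
    have hlt := hA.lt_of_not_selectable hσ h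
    exact ⟨0, by omega, by simp, by change K - (M + 1) < K - M; omega⟩
  | @expand M chain O tried B 𝓔 O' h =>
    obtain ⟨hs, hlen, hcls, htried⟩ := hσ
    have := hs.le
    refine lexLT_rank (k := chain.length) (by omega) (fun j hj => ?_) ?_
    · rw [Function.update_of_ne hj.ne, Function.update_of_ne (by rw [List.length_cons]; omega),
        chainRank, Function.update_of_ne hj.ne]
    · rw [Function.update_self, Function.update_of_ne (by simp), chainRank, Function.update_self]
      exact Nat.lt_add_of_pos_right two_pos
  | unsat hc hk h =>
    obtain ⟨hs, hlen, hcls, htried⟩ := hσ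
    have := hs.le
    have := remaining_insert_lt hcls htried
    exact lexLT_rank_of_lt (by omega) (by omega)
  | sat hc hk h =>
    obtain ⟨hs, hlen, hcls, htried⟩ := hσ
    have := hs.le
    exact lexLT_rank_of_lt (by omega) (by omega)
  | accept h hV => exact absurd rfl (hτ _)
  | @refute M chain O tried B 𝓔 cex a c h hV =>
    obtain ⟨hs, hlen, -⟩ := hσ
    have := hs.le
    have hlt := live_cons_lt (K := K) hP h
      (fun e he => (hs.level.length_le e he).trans (by omega)) hV
    cases cex <;>
      refine ⟨1, by omega, fun j hj => by rw [Nat.lt_one_iff.1 hj]; rfl, ?_⟩ <;>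
      · simp only [State.rank, rank]
        omega
  | @reject M chain O tried B 𝓔 cex h =>
    obtain ⟨hs, -, -, -, -, -, hcex⟩ := hσ
    cases cex with
    | nil =>
      obtain ⟨a, ha⟩ := hcex rfl
      exact absurd ha (h a)
    | cons c cex =>
      refine ⟨1, by omega, fun j hj => ?_, ?_⟩
      · obtain rfl : j = 0 := by omega
        rfl
      · simp only [State.rank, rank]
        omega

end Target

end Quintic

theorem mainTheorem2 {α : Type u} [Finite α] (P : Quintic.Problem α)
    (hform : P.form.Admissible P.Out) (hinit : P.form.Init (P.V []))
    (htarget : ∃ A : Quintic.Automaton.{u, w} α,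
      Finite A.Q ∧ (∀ q, A.label q ∈ P.Out) ∧ A.Computes P.form P.V) :
    (∀ h : Quintic.Automaton.{u, u} α, Quintic.Reachable P (Quintic.State.done h) →
      Finite h.Q ∧ (∀ q, h.label q ∈ P.Out) ∧ h.Computes P.form P.V ∧
      ∀ A : Quintic.Automaton.{u, v} α, Finite A.Q → A.Computes P.form P.V →
        Nat.card h.Q ≤ Nat.card A.Q) ∧
    (∀ σ : Quintic.State α, Quintic.Reachable P σ → (∀ τ, ¬ Quintic.Step P σ τ) →
      ∃ h, σ = Quintic.State.done h) ∧
    (P.Out.Finite → ¬ ∃ run : ℕ → Quintic.State α,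
      run 0 = Quintic.State.initial ∧ ∀ n, Quintic.Step P (run n) (run (n + 1))) := by
  obtain ⟨T, hfin, hlab, hT⟩ := htarget
  obtain ⟨N, hN⟩ := Quintic.exists_access_bound T
  obtain ⟨K, hK⟩ : ∃ K, K = {t : List α | t.length ≤ N + 1}.ncard + 2 + Nat.card T.Q := ⟨_, rfl⟩
  have hA : Quintic.IsTarget P T N K :=
    ⟨hfin, fun s => hlab _, hT, hinit, hN, by omega, by omega⟩
  refine ⟨fun h hh => ?_, fun σ _ => Quintic.exists_eq_done_of_stuck P σ, ?_⟩
  · have hinv : Quintic.Invariant P T N K (Quintic.State.done h) := by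
      unfold Quintic.Reachable at hh
      generalize Quintic.State.done h = σ at hh
      induction hh with
      | refl => exact hA.invariant_initial
      | tail _ hstep ih => exact hA.invariant_step ih hstep
    obtain ⟨O, 𝓔, B, hc, hk, hv, hV⟩ := hinv
    have hout := hv.label_mem
    obtain ⟨_, Λ, -, rfl, rfl, -⟩ := hv
    refine ⟨Quintic.Table.finite_hypothesis hc, hout, hV, fun A _ hAV => ?_⟩
    -- The competitor and the hypothesis have the same outputs, namely those of the target.
    have hlabels : ∀ {ℓ : List α → ℚ}, (∀ s, P.form.val ℓ s = P.V s) → ∀ s, ℓ s = T.output s :=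
      fun hℓ => Quintic.ValForm.eq_of_val_eq hform hA.output_mem fun s => (hℓ s).trans (hT s).symm
    exact Quintic.Table.card_hypothesis_le hc hk A fun t =>
      (hlabels (ℓ := A.output) hAV t).trans
        (hlabels (ℓ := (O.hypothesis _ Λ hc).output) hV t).symm
  · rintro hP ⟨run, h0, hrun⟩
    have hinv : ∀ n, Quintic.Invariant P T N K (run n) := by
      intro n
      induction n with
      | zero => rw [h0]; exact hA.invariant_initial
      | succ n ih => exact hA.invariant_step ih (hrun n)
    have hdone : ∀ n a, run n ≠ .done a := fun n a h => by
      have := hrun n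
      rw [h] at this
      cases this
    obtain ⟨_, ⟨n, rfl⟩, hmin⟩ := (Quintic.wellFounded_lexLT (K + 3)).has_min
      (Set.range fun n => (run n).rank P K) ⟨_, 0, rfl⟩
    exact hmin _ ⟨n + 1, rfl⟩ (hA.lexLT_of_step hP (hinv n) (hrun n) (hdone (n + 1)))
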